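/- All spaces are real. For a normed space $X$ with closed unit ball $B_X$ and unit sphere $S_X$, a slice of $B_X$ is a set $S(x^*,\varepsilon)=\{x\in B_X : x^*(x)>1-\varepsilon\}$ with $x^*\in S_{X^*}$ and $\varepsilon>0$. The space $X$ is - MLUR (midpoint locally uniformly rotund) if for every $x\in S_X$ and every sequence $(x_n)$ in $X$, $\|x\pm x_n\|\to 1$ implies $\|x_n\|\to 0$; - said to have the D2P (diameter 2 property) if every non-empty relatively weakly open subset of $B_X$ has diameter $2$; - said to have the LD2P+ if for every $x^*\in S_{X^*}$, all $\varepsilon,\delta>0$ and every $x\in S(x^*,\varepsilon)\cap S_X$ there is $y\in S(x^*,\varepsilon)$ with $\|x-y\|>2-\delta$. For a base $D=(D_n)_{n\ge1}$ of non-empty open subsets of $[0,1]$ let $X_D$ be the space $C[0,1]$ of real-valued continuous functions with the norm $$\|x\|_D=\Big(\sum_{n=1}^\infty 2^{-n}\sup_{d\in D_n}|x(d)|^2\Big)^{1/2}.$$ Let $(\varepsilon_n)_{n\ge1}$ be a strictly decreasing sequence of positive real numbers converging to $0$. For $n\ge1$ let $l\ge1$ and $0\le k<2^l$ be the integers with $n+1=2^l+k$,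 and let $$D_{1,n}=[0,1]\cap\Big(\frac{k}{2^{l}}-\varepsilon_n,\ \frac{k+1}{2^{l}}+\varepsilon_n\Big);$$ this interval is said to be of level $l$, so that level $l$ consists of $2^l$ consecutive intervals. For $i\ge1$ let $D_i=(D_{i,n})_{n\ge1}$ be the base of $[0,1]$ formed by the intervals of the levels $l\ge i$, in the same order and re-indexed from $1$, that is, $D_{i,n}=D_{1,\,n+2^i-2}$. **Theorem.** The $\ell_2$-sum $\ell_2\text{-}\bigoplus_{i=1}^\infty X_{D_i}$ is MLUR, has the D2P and has the LD2P+. Moreover, for every $r>0$ there are finitely many slices $S_1,\dots,S_m$ of its unit ball and $c_1,\dots,c_m\ge0$ with $\sum_j c_j=1$ such that the set $\sum_{j=1}^m c_jS_j=\{\sum_j c_jx_j : x_j\in S_j\}$ has diameter less than $r$. -/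

import Mathlib

open Set Filter Topology

/-! ### Geometry of the unit ball -/

/-- The slice `S(f, ε) = {x ∈ B_X : f x > 1 - ε}` of the closed unit ball (used for `‖f‖ = 1`
and `ε > 0`). -/
def ballSlice {X : Type*} [NormedAddCommGroup X] [NormedSpace ℝ X]
    (f : StrongDual ℝ X) (ε : ℝ) : Set X :=
  {x | x ∈ Metric.closedBall (0 : X) 1 ∧ 1 - ε < f x}

/-- Midpoint local uniform rotundity: every point of the unit sphere is strongly extreme. -/
def IsMLUR (X : Type*) [NormedAddCommGroup X] : Prop :=
  ∀ x : X, ‖x‖ = 1 → ∀ u : ℕ → X,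
    Tendsto (fun n => ‖x + u n‖) atTop (𝓝 1) → Tendsto (fun n => ‖x - u n‖) atTop (𝓝 1) →
      Tendsto u atTop (𝓝 0)

/-- The diameter 2 property: every non-empty relatively weakly open subset of the closed unit
ball has diameter 2. -/
def HasD2P (X : Type*) [NormedAddCommGroup X] [NormedSpace ℝ X] : Prop :=
  ∀ U : Set (WeakSpace ℝ X), IsOpen U →
    (Metric.closedBall (0 : X) 1 ∩ toWeakSpace ℝ X ⁻¹' U).Nonempty →
      Metric.diam (Metric.closedBall (0 : X) 1 ∩ toWeakSpace ℝ X ⁻¹' U) = 2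

/-- The local diameter 2 property +. -/
def HasLD2PPlus (X : Type*) [NormedAddCommGroup X] [NormedSpace ℝ X] : Prop :=
  ∀ f : StrongDual ℝ X, ‖f‖ = 1 → ∀ ε : ℝ, 0 < ε → ∀ δ : ℝ, 0 < δ →
    ∀ x ∈ ballSlice f ε, ‖x‖ = 1 → ∃ y ∈ ballSlice f ε, 2 - δ < ‖x - y‖

/-- `C` is a finite convex combination `∑ j, c j • S(f j, ε j)` (a Minkowski sum) of slices of
the closed unit ball. -/
def IsConvexCombOfSlices {X : Type*} [NormedAddCommGroup X] [NormedSpace ℝ X]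
    (C : Set X) : Prop :=
  ∃ (m : ℕ) (c : Fin m → ℝ) (f : Fin m → StrongDual ℝ X) (ε : Fin m → ℝ),
    (∀ j, 0 ≤ c j) ∧ ∑ j, c j = 1 ∧ (∀ j, ‖f j‖ = 1) ∧ (∀ j, 0 < ε j) ∧
      C = {z | ∃ x : Fin m → X, (∀ j, x j ∈ ballSlice (f j) (ε j)) ∧ z = ∑ j, c j • x j}

/-! ### The space `X_D` -/

/-- A countable base `(D_n)` of non-empty open sets of the unit interval, indexed from `0`. -/
structure NbhdBase where
  sets : ℕ → Set unitInterval
  nonempty : ∀ n, (sets n).Nonempty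
  isBasis : TopologicalSpace.IsTopologicalBasis (Set.range sets)

/-- The seminorm `sup_{d ∈ A} |x d|` on `C[0,1]`. -/
noncomputable def supOn (A : Set unitInterval) (x : C(unitInterval, ℝ)) : ℝ :=
  ⨆ d : A, |x d|

/-- The norm `(∑_{n ≥ 1} 2⁻ⁿ ‖x‖_n²)^{1/2}` on `C[0,1]`; as the base is indexed from `0`,
its `n`-th member has the weight `2^{-(n+1)}`. -/
noncomputable def dNorm (D : NbhdBase) (x : C(unitInterval, ℝ)) : ℝ :=
  Real.sqrt (∑' n : ℕ, (1 / 2 : ℝ) ^ (n + 1) * supOn (D.sets n) x ^ 2)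

theorem supOn_bdd (A : Set unitInterval) (x : C(unitInterval, ℝ)) :
    BddAbove (Set.range fun d : A => |x d|) :=
  ⟨‖x‖, by rintro _ ⟨d, rfl⟩; exact x.norm_coe_le_norm d⟩

theorem le_supOn {A : Set unitInterval} (x : C(unitInterval, ℝ)) {t : unitInterval}
    (ht : t ∈ A) : |x t| ≤ supOn A x :=
  le_ciSup (supOn_bdd A x) ⟨t, ht⟩

theorem supOn_nonneg (A : Set unitInterval) (x : C(unitInterval, ℝ)) : 0 ≤ supOn A x :=
  Real.iSup_nonneg fun _ => abs_nonneg _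

theorem supOn_le_norm (A : Set unitInterval) (x : C(unitInterval, ℝ)) : supOn A x ≤ ‖x‖ :=
  Real.iSup_le (fun d => x.norm_coe_le_norm d) (norm_nonneg x)

theorem supOn_add_le (A : Set unitInterval) (x y : C(unitInterval, ℝ)) :
    supOn A (x + y) ≤ supOn A x + supOn A y :=
  Real.iSup_le (fun d => (abs_add_le (x d) (y d)).trans
    (add_le_add (le_supOn x d.2) (le_supOn y d.2)))
    (add_nonneg (supOn_nonneg A x) (supOn_nonneg A y))

theorem supOn_smul (A : Set unitInterval) (c : ℝ) (x : C(unitInterval, ℝ)) :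
    supOn A (c • x) = |c| * supOn A x := by
  unfold supOn
  rw [Real.mul_iSup_of_nonneg (abs_nonneg c)]
  simp [abs_mul]

theorem dNorm_summable (D : NbhdBase) (x : C(unitInterval, ℝ)) :
    Summable fun n : ℕ => (1 / 2 : ℝ) ^ (n + 1) * supOn (D.sets n) x ^ 2 := by
  have h : Summable fun n : ℕ => (1 / 2 : ℝ) ^ (n + 1) * ‖x‖ ^ 2 :=
    ((summable_nat_add_iff 1).2 summable_geometric_two).mul_right _
  refine Summable.of_nonneg_of_le (fun n => by positivity) (fun n => ?_) h
  have := supOn_le_norm (D.sets n) x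
  have h0 := supOn_nonneg (D.sets n) x
  gcongr

theorem dNorm_smul (D : NbhdBase) (c : ℝ) (x : C(unitInterval, ℝ)) :
    dNorm D (c • x) = |c| * dNorm D x := by
  unfold dNorm
  have : ∀ n : ℕ, (1 / 2 : ℝ) ^ (n + 1) * supOn (D.sets n) (c • x) ^ 2
      = |c| ^ 2 * ((1 / 2 : ℝ) ^ (n + 1) * supOn (D.sets n) x ^ 2) := by
    intro n; rw [supOn_smul]; ring
  simp_rw [this]
  rw [tsum_mul_left, Real.sqrt_mul (by positivity), Real.sqrt_sq (abs_nonneg c)]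

theorem dNorm_zero (D : NbhdBase) : dNorm D 0 = 0 := by
  have h := dNorm_smul D 0 0
  simpa using h

theorem dNorm_neg (D : NbhdBase) (x : C(unitInterval, ℝ)) : dNorm D (-x) = dNorm D x := by
  have h := dNorm_smul D (-1) x
  rwa [abs_neg, abs_one, one_mul, neg_one_smul] at h

theorem dNorm_add_le (D : NbhdBase) (x y : C(unitInterval, ℝ)) :
    dNorm D (x + y) ≤ dNorm D x + dNorm D y := by
  have key : ∀ z : C(unitInterval, ℝ), ∀ n : ℕ,
      (Real.sqrt ((1 / 2 : ℝ) ^ (n + 1)) * supOn (D.sets n) z) ^ (2 : ℝ)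
        = (1 / 2 : ℝ) ^ (n + 1) * supOn (D.sets n) z ^ 2 := by
    intro z n
    rw [Real.rpow_two, mul_pow, Real.sq_sqrt (by positivity)]
  have hs : ∀ z : C(unitInterval, ℝ), Summable fun n : ℕ =>
      (Real.sqrt ((1 / 2 : ℝ) ^ (n + 1)) * supOn (D.sets n) z) ^ (2 : ℝ) := by
    intro z; simp_rw [key z]; exact dNorm_summable D z
  have hn : ∀ z : C(unitInterval, ℝ), ∀ n : ℕ,
      0 ≤ Real.sqrt ((1 / 2 : ℝ) ^ (n + 1)) * supOn (D.sets n) z := fun z n =>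
    mul_nonneg (Real.sqrt_nonneg _) (supOn_nonneg _ _)
  have hM := Real.Lp_add_le_tsum_of_nonneg (p := 2) (by norm_num) (hn x) (hn y) (hs x) (hs y)
  have h2 := hM.2
  simp_rw [key] at h2
  rw [← Real.sqrt_eq_rpow, ← Real.sqrt_eq_rpow, ← Real.sqrt_eq_rpow] at h2
  refine le_trans (Real.sqrt_le_sqrt ?_) h2
  refine (dNorm_summable D (x + y)).tsum_le_tsum (fun n => ?_) hM.1
  rw [← key (x + y) n, ← mul_add]
  exact Real.rpow_le_rpow (hn _ n)
    (mul_le_mul_of_nonneg_left (supOn_add_le _ _ _) (Real.sqrt_nonneg _)) (by norm_num)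

theorem dNorm_eq_zero (D : NbhdBase) (x : C(unitInterval, ℝ)) (h : dNorm D x = 0) : x = 0 := by
  have hnn : ∀ n : ℕ, 0 ≤ (1 / 2 : ℝ) ^ (n + 1) * supOn (D.sets n) x ^ 2 := fun n => by
    positivity
  have h0 := (Real.sqrt_eq_zero (tsum_nonneg hnn)).1 h
  have h1 := (hasSum_zero_iff_of_nonneg hnn).1 (h0 ▸ (dNorm_summable D x).hasSum)
  ext t
  obtain ⟨_, ⟨n, rfl⟩, ht, -⟩ := D.isBasis.exists_subset_of_mem_open (mem_univ t) isOpen_univ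
  have h2 : supOn (D.sets n) x = 0 := by
    have := congrFun h1 n
    simpa using this
  have h3 := le_supOn x ht
  rw [h2] at h3
  simpa using h3

/-- The space `X_D`: real-valued continuous functions on `[0,1]` with the norm `dNorm D`. -/
def XSpace (_D : NbhdBase) : Type := C(unitInterval, ℝ)

noncomputable instance XSpace.instAddCommGroup (D : NbhdBase) : AddCommGroup (XSpace D) :=
  inferInstanceAs (AddCommGroup C(unitInterval, ℝ))

noncomputable instance XSpace.instModule (D : NbhdBase) : Module ℝ (XSpace D) :=
  inferInstanceAs (Module ℝ C(unitInterval, ℝ))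

noncomputable instance XSpace.instNormedAddCommGroup (D : NbhdBase) :
    NormedAddCommGroup (XSpace D) :=
  AddGroupNorm.toNormedAddCommGroup
    { toFun := fun x => dNorm D x
      map_zero' := dNorm_zero D
      add_le' := fun x y => dNorm_add_le D x y
      neg' := fun x => dNorm_neg D x
      eq_zero_of_map_eq_zero' := fun x hx => dNorm_eq_zero D x hx }

theorem XSpace.norm_def (D : NbhdBase) (x : XSpace D) : ‖x‖ = dNorm D x := rfl

noncomputable instance XSpace.instNormedSpace (D : NbhdBase) : NormedSpace ℝ (XSpace D) where
  norm_smul_le c x := (dNorm_smul D c x).le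

/-! ### The dyadic bases -/

/-- The sequence of all enlarged dyadic intervals, in the order of the levels `1, 2, 3, …` and
from left to right within a level, indexed from `0`. The level `l ≥ 1` consists of the `2 ^ l`
indices `n` with `2 ^ l ≤ n + 2 < 2 ^ (l + 1)`, and for `k = n + 2 - 2 ^ l` the `n`-th set is
`(k / 2 ^ l - ε n, (k + 1) / 2 ^ l + ε n) ∩ [0,1]`. -/
def dyadicNbhd (ε : ℕ → ℝ) (n : ℕ) : Set unitInterval :=
  {t | (((n + 2 - 2 ^ Nat.log 2 (n + 2) : ℕ) : ℝ)) / 2 ^ Nat.log 2 (n + 2) - ε n < (t : ℝ) ∧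
    (t : ℝ) < (((n + 2 - 2 ^ Nat.log 2 (n + 2) : ℕ) : ℝ) + 1) / 2 ^ Nat.log 2 (n + 2) + ε n}

theorem mem_dyadicNbhd_iff (ε : ℕ → ℝ) {l k : ℕ} (hl : 1 ≤ l) (hk : k < 2 ^ l)
    (t : unitInterval) :
    t ∈ dyadicNbhd ε (2 ^ l + k - 2) ↔
      (k : ℝ) / 2 ^ l - ε (2 ^ l + k - 2) < (t : ℝ) ∧
        (t : ℝ) < ((k : ℝ) + 1) / 2 ^ l + ε (2 ^ l + k - 2) := by
  have h2 : 2 ≤ 2 ^ l := by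
    calc 2 = 2 ^ 1 := rfl
      _ ≤ 2 ^ l := Nat.pow_le_pow_right (by norm_num) hl
  have e : 2 ^ l + k - 2 + 2 = 2 ^ l + k := by omega
  have hlog : Nat.log 2 (2 ^ l + k) = l := by
    refine Nat.log_eq_of_pow_le_of_lt_pow (by omega) ?_
    rw [pow_succ]; omega
  unfold dyadicNbhd
  rw [mem_ofPred_eq, e, hlog, Nat.add_sub_cancel_left]

theorem dyadicNbhd_isOpen (ε : ℕ → ℝ) (n : ℕ) : IsOpen (dyadicNbhd ε n) :=
  (isOpen_lt continuous_const continuous_subtype_val).inter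
    (isOpen_lt continuous_subtype_val continuous_const)

theorem dyadicNbhd_nonempty (ε : ℕ → ℝ) (hpos : ∀ n, 0 < ε n) (n : ℕ) :
    (dyadicNbhd ε n).Nonempty := by
  have h1 : 2 ^ Nat.log 2 (n + 2) ≤ n + 2 := Nat.pow_log_le_self 2 (by omega)
  have h2 : n + 2 < 2 ^ (Nat.log 2 (n + 2) + 1) := Nat.lt_pow_succ_log_self (by norm_num) _
  rw [pow_succ] at h2
  have h3 : n + 2 - 2 ^ Nat.log 2 (n + 2) ≤ 2 ^ Nat.log 2 (n + 2) := by omega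
  have h3' : ((n + 2 - 2 ^ Nat.log 2 (n + 2) : ℕ) : ℝ) ≤ 2 ^ Nat.log 2 (n + 2) := by
    exact_mod_cast h3
  have hp : (0 : ℝ) < 2 ^ Nat.log 2 (n + 2) := by positivity
  have h4 := hpos n
  refine ⟨⟨((n + 2 - 2 ^ Nat.log 2 (n + 2) : ℕ) : ℝ) / 2 ^ Nat.log 2 (n + 2), by positivity,
    (div_le_one hp).2 h3'⟩, ?_, ?_⟩
  · simp only; linarith
  · have h5 : ((n + 2 - 2 ^ Nat.log 2 (n + 2) : ℕ) : ℝ) / 2 ^ Nat.log 2 (n + 2)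
        ≤ (((n + 2 - 2 ^ Nat.log 2 (n + 2) : ℕ) : ℝ) + 1) / 2 ^ Nat.log 2 (n + 2) := by
      gcongr; linarith
    simp only; linarith

theorem exists_dyadic_cell (t : unitInterval) (l : ℕ) :
    ∃ k : ℕ, k < 2 ^ l ∧ (k : ℝ) / 2 ^ l ≤ t ∧ (t : ℝ) ≤ ((k : ℝ) + 1) / 2 ^ l := by
  have hp : (0 : ℝ) < 2 ^ l := by positivity
  have hpn : 0 < 2 ^ l := by positivity
  have ht0 := t.2.1
  have ht1 := t.2.2
  by_cases h : (t : ℝ) = 0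
  · refine ⟨0, hpn, ?_, ?_⟩
    · simp [h]
    · rw [h]; positivity
  · have htp : (0 : ℝ) < t * 2 ^ l := mul_pos (lt_of_le_of_ne ht0 (Ne.symm h)) hp
    have hc : 0 < ⌈(t : ℝ) * 2 ^ l⌉₊ := Nat.ceil_pos.2 htp
    obtain ⟨k, hk⟩ : ∃ k, ⌈(t : ℝ) * 2 ^ l⌉₊ = k + 1 := ⟨_, (Nat.succ_pred_eq_of_pos hc).symm⟩
    have hle : ⌈(t : ℝ) * 2 ^ l⌉₊ ≤ 2 ^ l := by
      refine Nat.ceil_le.2 ?_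
      push_cast
      nlinarith
    have h1 : (t : ℝ) * 2 ^ l ≤ (k : ℝ) + 1 := by
      have := Nat.le_ceil ((t : ℝ) * 2 ^ l)
      rw [hk] at this
      exact_mod_cast this
    have h2 : (k : ℝ) < t * 2 ^ l := Nat.lt_ceil.1 (by omega)
    exact ⟨k, by omega, (div_le_iff₀ hp).2 h2.le, (le_div_iff₀ hp).2 h1⟩

theorem dyadicNbhd_isBasis (ε : ℕ → ℝ) (hpos : ∀ n, 0 < ε n) (hlim : Tendsto ε atTop (𝓝 0))
    (i : ℕ) : TopologicalSpace.IsTopologicalBasis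
      (Set.range fun n : ℕ => dyadicNbhd ε (2 ^ (i + 1) - 2 + n)) := by
  refine TopologicalSpace.isTopologicalBasis_of_isOpen_of_nhds ?_ ?_
  · rintro _ ⟨n, rfl⟩
    exact dyadicNbhd_isOpen _ _
  · intro t U ht hU
    obtain ⟨δ, hδ, hball⟩ := Metric.isOpen_iff.1 hU t ht
    obtain ⟨N, hN⟩ := eventually_atTop.1 (hlim.eventually (gt_mem_nhds (show 0 < δ / 4 by linarith)))
    obtain ⟨M, hM⟩ := exists_pow_lt_of_lt_one (show 0 < δ / 2 by linarith)
      (show (1 / 2 : ℝ) < 1 by norm_num)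
    obtain ⟨l, hlM, hlN, hli⟩ : ∃ l, M ≤ l ∧ N + 1 ≤ l ∧ i + 1 ≤ l :=
      ⟨M + (N + 1) + (i + 1), by omega, by omega, by omega⟩
    obtain ⟨k, hk, hk1, hk2⟩ := exists_dyadic_cell t l
    have hl2 : l + 1 ≤ 2 ^ l := Nat.lt_two_pow_self
    have hi2 : 2 ^ (i + 1) ≤ 2 ^ l := Nat.pow_le_pow_right (by norm_num) hli
    have hi3 : 2 ≤ 2 ^ (i + 1) := by
      calc 2 = 2 ^ 1 := rfl
        _ ≤ 2 ^ (i + 1) := Nat.pow_le_pow_right (by norm_num) (by omega)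
    have hεp := hpos (2 ^ l + k - 2)
    refine ⟨_, ⟨2 ^ l + k - 2 ^ (i + 1), rfl⟩, ?_, ?_⟩
    all_goals
      have e : 2 ^ (i + 1) - 2 + (2 ^ l + k - 2 ^ (i + 1)) = 2 ^ l + k - 2 := by omega
      simp only [e]
    · rw [mem_dyadicNbhd_iff ε (by omega) hk]
      constructor <;> linarith
    · intro s hs
      rw [mem_dyadicNbhd_iff ε (by omega) hk] at hs
      apply hball
      rw [Metric.mem_ball, Subtype.dist_eq, Real.dist_eq, abs_lt]
      have hε := hN (2 ^ l + k - 2) (by omega)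
      have hw : (1 / 2 : ℝ) ^ l < δ / 2 :=
        lt_of_le_of_lt (pow_le_pow_of_le_one (by norm_num) (by norm_num) hlM) hM
      have hsplit : ((k : ℝ) + 1) / 2 ^ l = (k : ℝ) / 2 ^ l + (1 / 2 : ℝ) ^ l := by
        rw [add_div, one_div_pow]
      obtain ⟨hs1, hs2⟩ := hs
      rw [hsplit] at hs2 hk2
      constructor <;> linarith

/-- The base consisting of the enlarged dyadic intervals of all levels `≥ i + 1`, in their order
and re-indexed from the beginning (the levels below `i + 1` hold `2 ^ (i + 1) - 2` intervals).
For `i = 0, 1, 2, …` these are the bases `D_1, D_2, D_3, …`. -/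
def dyadicBase (ε : ℕ → ℝ) (hpos : ∀ n, 0 < ε n) (hlim : Tendsto ε atTop (𝓝 0)) (i : ℕ) :
    NbhdBase where
  sets n := dyadicNbhd ε (2 ^ (i + 1) - 2 + n)
  nonempty _ := dyadicNbhd_nonempty ε hpos _
  isBasis := dyadicNbhd_isBasis ε hpos hlim i

/-- The `ℓ_2`-sum of the spaces `X_{D_i}`, `i = 1, 2, 3, …`. -/
abbrev L2SumXSpace (ε : ℕ → ℝ) (hpos : ∀ n, 0 < ε n) (hlim : Tendsto ε atTop (𝓝 0)) : Type :=
  lp (fun i : ℕ => XSpace (dyadicBase ε hpos hlim i)) 2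

/-!
If `N ^ 2 = ∑ w a * p a ^ 2` for seminorms `p a`, then `N (x + u) ^ 2 + N (x - u) ^ 2 - 2 * N x ^ 2`
dominates every `w a * (p a (x + u) - p a x) ^ 2`. So if `x` is asymptotically the midpoint of the
points `x ± u k` in the sense of `N`, it is so for each `p a`. For `X_D` this forces `u k → 0` near
each point of `[0,1]`, since `|x|` is nearly constant on a small member of the base; for `ℓ₂`-sums
it reduces MLUR to the summands.

Composing tents on `[-1,1]` of height `1` and with disjoint supports with a fast oscillation
`s ↦ sin (M s)` gives disjointly supported multipliers `φ k` which take the value `1` close to every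
point of `[0,1]`. The functions `φ k * x` are then weakly null and have almost the norm of `x`, so
that `(1 - 2 * φ k) * x` tends weakly to `x`, lies in the ball of radius `‖x‖`, and has distance
almost `2 * ‖x‖` from `x`. This is inherited by `ℓ₂`-sums and gives the D2P and the LD2P+.

On the other hand, a thin slice at a point evaluation consists of functions that are small away from
that point. An average of `m` functions from such slices at different points is a sum of almost
disjoint functions, and its norm is of order `1 / √m`.
-/

/-! ### `ℓ₂`-sums -/

section LpTwo

variable {ι : Type*} {E : ι → Type*} [∀ i, NormedAddCommGroup (E i)]

theorem hasSum_sq_norm_lp_two (x : lp E 2) : HasSum (fun i => ‖x i‖ ^ 2) (‖x‖ ^ 2) := by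
  simpa [ENNReal.toReal_ofNat, Real.rpow_two] using lp.hasSum_norm (p := 2) (by norm_num) x

theorem norm_lp_two_le_of_forall_le {x y : lp E 2} (h : ∀ i, ‖x i‖ ≤ ‖y i‖) : ‖x‖ ≤ ‖y‖ :=
  le_of_sq_le_sq (hasSum_le (fun i => pow_le_pow_left₀ (norm_nonneg _) (h i) 2)
    (hasSum_sq_norm_lp_two x) (hasSum_sq_norm_lp_two y)) (norm_nonneg y)

variable [DecidableEq ι]

theorem sq_norm_sum_single_lp_two (v : ∀ i, E i) (F : Finset ι) :
    ‖∑ i ∈ F, (lp.single 2 i (v i) : lp E 2)‖ ^ 2 = ∑ i ∈ F, ‖v i‖ ^ 2 := by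
  simpa [ENNReal.toReal_ofNat, Real.rpow_two] using
    lp.norm_sum_single (p := 2) (by norm_num) v F

theorem sq_norm_sub_single_lp_two (x : lp E 2) (i : ι) :
    ‖x - lp.single 2 i (x i)‖ ^ 2 = ‖x‖ ^ 2 - ‖x i‖ ^ 2 := by
  simpa [ENNReal.toReal_ofNat, Real.rpow_two] using
    lp.norm_compl_sum_single (p := 2) (by norm_num) x {i}

theorem sum_single_lp_two_apply (v : ∀ i, E i) (F : Finset ι) (i : ι) :
    (∑ j ∈ F, (lp.single 2 j (v j) : lp E 2)) i = if i ∈ F then v i else 0 := by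
  simp only [lp.coeFn_sum, Finset.sum_apply, lp.coeFn_single, Finset.sum_pi_single]

end LpTwo

/-! ### Midpoints in sums of squares of seminorms -/

section Midpoint

theorem sq_seminorm_sub_le_midpoint_defect {V : Type*} [AddCommGroup V] [Module ℝ V]
    (p : Seminorm ℝ V) (x u : V) :
    (p (x + u) - p x) ^ 2 ≤ p (x + u) ^ 2 + p (x - u) ^ 2 - 2 * p x ^ 2 := by
  have hmid : 2 * p x ≤ p (x + u) + p (x - u) := by
    have h := map_add_le_add p (x + u) (x - u)
    rwa [add_add_sub_cancel, ← two_smul ℝ x, map_smul_eq_mul, Real.norm_ofNat] at h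
  nlinarith [apply_nonneg p x, sq_nonneg (p (x - u) - p x),
    mul_nonneg (apply_nonneg p x) (sub_nonneg.2 hmid)]

variable {α κ V : Type*} [AddCommGroup V] [Module ℝ V] {w : α → ℝ} {p : α → Seminorm ℝ V}
  {N : V → ℝ} {l : Filter κ} {x : V} {u : κ → V}

theorem mul_sq_seminorm_sub_le_midpoint_defect (hw : ∀ a, 0 ≤ w a) (x u : V) (a : α) :
    w a * (p a (x + u) - p a x) ^ 2 ≤
      w a * p a (x + u) ^ 2 + w a * p a (x - u) ^ 2 - 2 * (w a * p a x ^ 2) := by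
  have h := mul_le_mul_of_nonneg_left (sq_seminorm_sub_le_midpoint_defect (p a) x u) (hw a)
  linarith

theorem hasSum_midpoint_defect (hN : ∀ y, HasSum (fun a => w a * p a y ^ 2) (N y ^ 2)) (x u : V) :
    HasSum (fun a => w a * p a (x + u) ^ 2 + w a * p a (x - u) ^ 2 - 2 * (w a * p a x ^ 2))
      (N (x + u) ^ 2 + N (x - u) ^ 2 - 2 * N x ^ 2) :=
  ((hN _).add (hN _)).sub ((hN x).mul_left 2)

theorem summable_mul_sq_seminorm_sub (hw : ∀ a, 0 ≤ w a)
    (hN : ∀ y, HasSum (fun a => w a * p a y ^ 2) (N y ^ 2)) (x u : V) :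
    Summable fun a => w a * (p a (x + u) - p a x) ^ 2 :=
  .of_nonneg_of_le (fun a => mul_nonneg (hw a) (sq_nonneg _))
    (mul_sq_seminorm_sub_le_midpoint_defect hw x u) (hasSum_midpoint_defect hN x u).summable

theorem tendsto_tsum_mul_sq_seminorm_sub (hw : ∀ a, 0 ≤ w a)
    (hN : ∀ y, HasSum (fun a => w a * p a y ^ 2) (N y ^ 2))
    (hadd : Tendsto (fun k => N (x + u k)) l (𝓝 (N x)))
    (hsub : Tendsto (fun k => N (x - u k)) l (𝓝 (N x))) :
    Tendsto (fun k => ∑' a, w a * (p a (x + u k) - p a x) ^ 2) l (𝓝 0) := by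
  have hdefect : Tendsto (fun k => N (x + u k) ^ 2 + N (x - u k) ^ 2 - 2 * N x ^ 2) l (𝓝 0) := by
    have h := ((hadd.pow 2).add (hsub.pow 2)).sub_const (2 * N x ^ 2)
    rwa [← two_mul, sub_self] at h
  exact squeeze_zero (fun k => tsum_nonneg fun a => mul_nonneg (hw a) (sq_nonneg _))
    (fun k => hasSum_le (mul_sq_seminorm_sub_le_midpoint_defect hw x (u k))
      (summable_mul_sq_seminorm_sub hw hN x (u k)).hasSum (hasSum_midpoint_defect hN x (u k)))
    hdefect

theorem tendsto_seminorm_add_of_midpoint (hw : ∀ a, 0 < w a)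
    (hN : ∀ y, HasSum (fun a => w a * p a y ^ 2) (N y ^ 2))
    (hadd : Tendsto (fun k => N (x + u k)) l (𝓝 (N x)))
    (hsub : Tendsto (fun k => N (x - u k)) l (𝓝 (N x))) (a : α) :
    Tendsto (fun k => p a (x + u k)) l (𝓝 (p a x)) := by
  have hw' := fun b => (hw b).le
  have hterm : Tendsto (fun k => w a * (p a (x + u k) - p a x) ^ 2) l (𝓝 0) :=
    squeeze_zero (fun k => mul_nonneg (hw' a) (sq_nonneg _))
      (fun k => (summable_mul_sq_seminorm_sub hw' hN x (u k)).le_tsum a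
        fun b _ => mul_nonneg (hw' b) (sq_nonneg _))
      (tendsto_tsum_mul_sq_seminorm_sub hw' hN hadd hsub)
  have hsq : Tendsto (fun k => (p a (x + u k) - p a x) ^ 2) l (𝓝 0) := by
    simpa only [inv_mul_cancel_left₀ (hw a).ne', mul_zero] using hterm.const_mul (w a)⁻¹
  have habs : Tendsto (fun k => |p a (x + u k) - p a x|) l (𝓝 0) := by
    simpa only [Real.sqrt_sq_eq_abs, Real.sqrt_zero] using hsq.sqrt
  exact tendsto_sub_nhds_zero_iff.1 ((tendsto_zero_iff_abs_tendsto_zero _).2 habs)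

theorem tendsto_seminorm_sub_of_midpoint (hw : ∀ a, 0 < w a)
    (hN : ∀ y, HasSum (fun a => w a * p a y ^ 2) (N y ^ 2))
    (hadd : Tendsto (fun k => N (x + u k)) l (𝓝 (N x)))
    (hsub : Tendsto (fun k => N (x - u k)) l (𝓝 (N x))) (a : α) :
    Tendsto (fun k => p a (x - u k)) l (𝓝 (p a x)) := by
  simp only [sub_eq_add_neg] at hsub ⊢
  exact tendsto_seminorm_add_of_midpoint (u := fun k => -u k) hw hN hsub
    (by simpa only [sub_neg_eq_add] using hadd) a

end Midpoint

/-- Since `f ≤ min f |g| + h`, dominated convergence is only needed for `min f |g|`. -/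
theorem tendsto_tsum_zero_of_le_add {α κ : Type*} {l : Filter κ} {f h : κ → α → ℝ} {g : α → ℝ}
    (hf : ∀ k a, 0 ≤ f k a) (hh : ∀ k a, 0 ≤ h k a) (hfgh : ∀ k a, f k a ≤ g a + h k a)
    (hg : Summable g) (hhs : ∀ k, Summable (h k)) (hh0 : Tendsto (fun k => ∑' a, h k a) l (𝓝 0))
    (hf0 : ∀ a, Tendsto (fun k => f k a) l (𝓝 0)) :
    Tendsto (fun k => ∑' a, f k a) l (𝓝 0) := by
  have hmin0 : ∀ k a, 0 ≤ min (f k a) |g a| := fun k a => le_min (hf k a) (abs_nonneg _)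
  have hmins : ∀ k, Summable fun a => min (f k a) |g a| := fun k =>
    .of_nonneg_of_le (hmin0 k) (fun a => min_le_right _ _) hg.abs
  have hmin : Tendsto (fun k => ∑' a, min (f k a) |g a|) l (𝓝 0) := by
    simpa only [tsum_zero] using tendsto_tsum_of_dominated_convergence hg.abs
      (fun a => squeeze_zero (fun k => hmin0 k a) (fun k => min_le_left _ _) (hf0 a))
      (Eventually.of_forall fun k a => by
        rw [Real.norm_of_nonneg (hmin0 k a)]; exact min_le_right _ _)
  have hle : ∀ k a, f k a ≤ min (f k a) |g a| + h k a := fun k a => by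
    rw [min_add, le_min_iff]
    exact ⟨le_add_of_nonneg_right (hh k a), (hfgh k a).trans (by gcongr; exact le_abs_self _)⟩
  have hbound := fun k => (hmins k).add (hhs k)
  refine squeeze_zero (fun k => tsum_nonneg (hf k)) (fun k => ?_) (by simpa using hmin.add hh0)
  rw [← (hmins k).tsum_add (hhs k)]
  exact (Summable.of_nonneg_of_le (hf k) (hle k) (hbound k)).tsum_le_tsum (hle k) (hbound k)

theorem IsMLUR.tendsto_zero {X : Type*} [NormedAddCommGroup X] [NormedSpace ℝ X] (hX : IsMLUR X)
    {x : X} {u : ℕ → X}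
    (hadd : Tendsto (fun k => ‖x + u k‖) atTop (𝓝 ‖x‖))
    (hsub : Tendsto (fun k => ‖x - u k‖) atTop (𝓝 ‖x‖)) : Tendsto u atTop (𝓝 0) := by
  rcases eq_or_ne x 0 with rfl | hx
  · simpa only [zero_add, norm_zero, ← tendsto_zero_iff_norm_tendsto_zero] using hadd
  have hx' : ‖x‖ ≠ 0 := norm_ne_zero_iff.2 hx
  have hnorm : ∀ y : X, ‖‖x‖⁻¹ • y‖ = ‖x‖⁻¹ * ‖y‖ := fun y => by
    rw [norm_smul, norm_inv, norm_norm]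
  have hscaled : Tendsto (fun k => ‖x‖⁻¹ • u k) atTop (𝓝 0) := by
    refine hX (‖x‖⁻¹ • x) (by rw [hnorm, inv_mul_cancel₀ hx']) _ ?_ ?_
    · simpa only [← smul_add, hnorm, inv_mul_cancel₀ hx'] using hadd.const_mul ‖x‖⁻¹
    · simpa only [← smul_sub, hnorm, inv_mul_cancel₀ hx'] using hsub.const_mul ‖x‖⁻¹
  simpa only [smul_inv_smul₀ hx', smul_zero] using hscaled.const_smul ‖x‖

theorem sq_norm_le_mul_sq_norm_add {X : Type*} [SeminormedAddCommGroup X] (x u : X) :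
    ‖u‖ ^ 2 ≤ 8 * ‖x‖ ^ 2 + 2 * (‖x + u‖ - ‖x‖) ^ 2 := by
  have htri : ‖u‖ ≤ ‖x + u‖ + ‖x‖ := by
    simpa only [add_sub_cancel_left] using norm_sub_le (x + u) x
  nlinarith [norm_nonneg u, norm_nonneg x, norm_nonneg (x + u),
    sq_nonneg (‖x + u‖ - ‖x‖ - 2 * ‖x‖)]

theorem IsMLUR.lp_two {ι : Type*} {E : ι → Type*} [∀ i, NormedAddCommGroup (E i)]
    [∀ i, NormedSpace ℝ (E i)] (hE : ∀ i, IsMLUR (E i)) : IsMLUR (lp E 2) := by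
  intro x hx u hadd hsub
  rw [← hx] at hadd hsub
  let p : ι → Seminorm ℝ (lp E 2) := fun i =>
    (normSeminorm ℝ (E i)).comp (lp.evalCLM ℝ E 2 i).toLinearMap
  have hp : ∀ y : lp E 2, HasSum (fun i => (1 : ℝ) * p i y ^ 2) (‖y‖ ^ 2) := fun y => by
    simp only [one_mul]
    exact hasSum_sq_norm_lp_two y
  have hcoord : ∀ i, Tendsto (fun k => u k i) atTop (𝓝 0) := fun i =>
    (hE i).tendsto_zero
      (tendsto_seminorm_add_of_midpoint (fun _ => one_pos) hp hadd hsub i)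
      (tendsto_seminorm_sub_of_midpoint (fun _ => one_pos) hp hadd hsub i)
  have hdefect := (tendsto_tsum_mul_sq_seminorm_sub (fun _ => zero_le_one) hp hadd hsub).const_mul 2
  have hsq : Tendsto (fun k => ∑' i, ‖u k i‖ ^ 2) atTop (𝓝 0) := by
    refine tendsto_tsum_zero_of_le_add (fun k i => sq_nonneg _)
      (h := fun k i => 2 * (1 * (p i (x + u k) - p i x) ^ 2)) (fun k i => by positivity)
      (fun k i => ?_) ((hasSum_sq_norm_lp_two x).summable.mul_left 8)
      (fun k => (summable_mul_sq_seminorm_sub (fun _ => zero_le_one) hp x (u k)).mul_left 2)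
      (by simpa only [tsum_mul_left, mul_zero] using hdefect)
      (fun i => by simpa using (hcoord i).norm.pow 2)
    rw [one_mul]
    exact sq_norm_le_mul_sq_norm_add (x i) (u k i)
  simp only [(hasSum_sq_norm_lp_two _).tsum_eq] at hsq
  rw [tendsto_zero_iff_norm_tendsto_zero]
  simpa only [Real.sqrt_sq (norm_nonneg _), Real.sqrt_zero] using hsq.sqrt

/-! ### The norm of `X_D` -/

theorem supOn_le {A : Set unitInterval} {x : C(unitInterval, ℝ)} {c : ℝ} (hc : 0 ≤ c)
    (h : ∀ s ∈ A, |x s| ≤ c) : supOn A x ≤ c :=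
  Real.iSup_le (fun d => h d d.2) hc

theorem supOn_mul_le (A : Set unitInterval) {φ : C(unitInterval, ℝ)} (hφ : ∀ s, |φ s| ≤ 1)
    (x : C(unitInterval, ℝ)) : supOn A (φ * x) ≤ supOn A x :=
  supOn_le (supOn_nonneg A x) fun s hs => by
    rw [ContinuousMap.mul_apply, abs_mul]
    exact (mul_le_of_le_one_left (abs_nonneg _) (hφ s)).trans (le_supOn x hs)

/-- `supOn A` as a `Seminorm`, which makes `dNorm D ^ 2` a weighted sum of squares of seminorms. -/
noncomputable def supSeminorm (A : Set unitInterval) : Seminorm ℝ C(unitInterval, ℝ) :=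
  .of (supOn A) (supOn_add_le A) (supOn_smul A)

theorem dNorm_nonneg (D : NbhdBase) (x : C(unitInterval, ℝ)) : 0 ≤ dNorm D x :=
  Real.sqrt_nonneg _

theorem hasSum_sq_dNorm (D : NbhdBase) (x : C(unitInterval, ℝ)) :
    HasSum (fun n : ℕ => (1 / 2 : ℝ) ^ (n + 1) * supOn (D.sets n) x ^ 2) (dNorm D x ^ 2) := by
  rw [dNorm, Real.sq_sqrt (tsum_nonneg fun n => by positivity)]
  exact (dNorm_summable D x).hasSum

theorem hasSum_half_pow_succ : HasSum (fun n : ℕ => (1 / 2 : ℝ) ^ (n + 1)) 1 := by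
  simpa only [pow_succ', one_div_mul_cancel (two_ne_zero' ℝ)] using
    hasSum_geometric_two.mul_left (1 / 2 : ℝ)

theorem dNorm_le_norm (D : NbhdBase) (x : C(unitInterval, ℝ)) : dNorm D x ≤ ‖x‖ := by
  have hnorm : HasSum (fun n : ℕ => (1 / 2 : ℝ) ^ (n + 1) * ‖x‖ ^ 2) (‖x‖ ^ 2) := by
    simpa only [one_mul] using hasSum_half_pow_succ.mul_right (‖x‖ ^ 2)
  refine le_of_sq_le_sq (hasSum_le (fun n => ?_) (hasSum_sq_dNorm D x) hnorm) (norm_nonneg x)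
  have := supOn_nonneg (D.sets n) x
  gcongr
  exact supOn_le_norm _ x

theorem dNorm_mul_le (D : NbhdBase) {φ : C(unitInterval, ℝ)} (hφ : ∀ s, |φ s| ≤ 1)
    (x : C(unitInterval, ℝ)) : dNorm D (φ * x) ≤ dNorm D x := by
  refine le_of_sq_le_sq
    (hasSum_le (fun n => ?_) (hasSum_sq_dNorm D _) (hasSum_sq_dNorm D x)) (dNorm_nonneg D x)
  have := supOn_nonneg (D.sets n) (φ * x)
  gcongr
  exact supOn_mul_le _ hφ x

/-- The identity between `X_D` and `C[0,1]`; it is isometric only for `dNorm D` on the right. -/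
def XSpace.equiv (D : NbhdBase) : XSpace D ≃ₗ[ℝ] C(unitInterval, ℝ) :=
  LinearEquiv.refl ℝ C(unitInterval, ℝ)

theorem XSpace.norm_eq_dNorm {D : NbhdBase} (x : XSpace D) : ‖x‖ = dNorm D (XSpace.equiv D x) :=
  rfl

theorem XSpace.norm_equiv_symm {D : NbhdBase} (x : C(unitInterval, ℝ)) :
    ‖(XSpace.equiv D).symm x‖ = dNorm D x :=
  rfl

theorem NbhdBase.isOpen_sets (D : NbhdBase) (n : ℕ) : IsOpen (D.sets n) :=
  D.isBasis.isOpen ⟨n, rfl⟩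

theorem NbhdBase.exists_mem_subset (D : NbhdBase) {t : unitInterval} {V : Set unitInterval}
    (hV : V ∈ 𝓝 t) : ∃ n, t ∈ D.sets n ∧ D.sets n ⊆ V := by
  obtain ⟨_, ⟨n, rfl⟩, ht, hs⟩ := D.isBasis.mem_nhds_iff.1 hV
  exact ⟨n, ht, hs⟩

theorem abs_add_abs_le_max (a b : ℝ) : |a| + |b| ≤ max |a + b| |a - b| := by
  rcases abs_cases a with ha | ha <;> rcases abs_cases b with hb | hb <;>
    rw [ha.1, hb.1, le_max_iff, le_abs, le_abs] <;> grind

theorem NbhdBase.exists_supOn_le_abs_add (D : NbhdBase) (x : C(unitInterval, ℝ))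
    (t : unitInterval) {η : ℝ} (hη : 0 < η) :
    ∃ n, t ∈ D.sets n ∧ ∀ s ∈ D.sets n, supOn (D.sets n) x ≤ |x s| + η := by
  have hV : {s | |x s - x t| < η / 2} ∈ 𝓝 t :=
    (isOpen_lt (by fun_prop) continuous_const).mem_nhds (by simpa using hη)
  obtain ⟨n, htn, hn⟩ := D.exists_mem_subset hV
  refine ⟨n, htn, fun s hs => supOn_le (by positivity) fun d hd => ?_⟩
  have hst : |x s - x t| < η / 2 := hn hs
  have hdt : |x d - x t| < η / 2 := hn hd
  have hds : |x d| - |x s| ≤ |x d - x t| + |x s - x t| := by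
    rw [abs_sub_comm (x s)]
    exact (abs_sub_abs_le_abs_sub _ _).trans (abs_sub_le _ _ _)
  linarith

theorem tendsto_zero_of_tendsto_supOn (D : NbhdBase) {κ : Type*} {l : Filter κ}
    {x : C(unitInterval, ℝ)} {u : κ → C(unitInterval, ℝ)}
    (hadd : ∀ n, Tendsto (fun k => supOn (D.sets n) (x + u k)) l (𝓝 (supOn (D.sets n) x)))
    (hsub : ∀ n, Tendsto (fun k => supOn (D.sets n) (x - u k)) l (𝓝 (supOn (D.sets n) x))) :
    Tendsto u l (𝓝 0) := by
  rw [ContinuousMap.tendsto_iff_tendstoUniformly,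
    ← tendstoLocallyUniformly_iff_tendstoUniformly_of_compactSpace,
    Metric.tendstoLocallyUniformly_iff]
  intro η hη t
  obtain ⟨n, htn, hn⟩ := D.exists_supOn_le_abs_add x t (half_pos hη)
  refine ⟨D.sets n, (D.isOpen_sets n).mem_nhds htn, ?_⟩
  have hlt : supOn (D.sets n) x < supOn (D.sets n) x + η / 2 := by linarith
  filter_upwards [(hadd n).eventually_lt_const hlt, (hsub n).eventually_lt_const hlt]
    with k hk_add hk_sub s hs
  rw [ContinuousMap.zero_apply, dist_zero_left, Real.norm_eq_abs]
  have hmax : |x s| + |u k s| < supOn (D.sets n) x + η / 2 :=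
    (abs_add_abs_le_max _ _).trans_lt <| max_lt ((le_supOn (x + u k) hs).trans_lt hk_add)
      ((le_supOn (x - u k) hs).trans_lt hk_sub)
  linarith [hn s hs]

theorem tendsto_zero_of_tendsto_dNorm (D : NbhdBase) {κ : Type*} {l : Filter κ}
    {x : C(unitInterval, ℝ)} {u : κ → C(unitInterval, ℝ)}
    (hadd : Tendsto (fun k => dNorm D (x + u k)) l (𝓝 (dNorm D x)))
    (hsub : Tendsto (fun k => dNorm D (x - u k)) l (𝓝 (dNorm D x))) :
    Tendsto u l (𝓝 0) :=
  have hw : ∀ n : ℕ, (0 : ℝ) < (1 / 2) ^ (n + 1) := fun n => by positivity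
  tendsto_zero_of_tendsto_supOn D
    (tendsto_seminorm_add_of_midpoint (p := fun n => supSeminorm (D.sets n)) hw
      (hasSum_sq_dNorm D) hadd hsub)
    (tendsto_seminorm_sub_of_midpoint (p := fun n => supSeminorm (D.sets n)) hw
      (hasSum_sq_dNorm D) hadd hsub)

theorem XSpace.isMLUR (D : NbhdBase) : IsMLUR (XSpace D) := by
  intro x hx u hadd hsub
  rw [← hx] at hadd hsub
  simp only [XSpace.norm_eq_dNorm, map_add, map_sub] at hadd hsub
  have hnorm := (tendsto_zero_of_tendsto_dNorm D hadd hsub).norm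
  rw [norm_zero] at hnorm
  exact tendsto_zero_iff_norm_tendsto_zero.2
    (squeeze_zero (fun k => norm_nonneg _) (fun k => dNorm_le_norm D _) hnorm)

/-! ### Diametral diameter 2 properties -/

/-- A sequential form of the diametral diameter 2 property: every `x` is a weak limit of points
`y k` with `‖y k‖ ≤ ‖x‖` and almost the largest distance `2 * ‖x‖` to `x`. -/
def HasSeqDD2P (X : Type*) [NormedAddCommGroup X] [NormedSpace ℝ X] : Prop :=
  ∀ x : X, ∀ c < (2 : ℝ), ∃ y : ℕ → X, (∀ k, ‖y k‖ ≤ ‖x‖) ∧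
    (∀ f : StrongDual ℝ X, Tendsto (fun k => f (y k)) atTop (𝓝 (f x))) ∧
      ∀ k, c * ‖x‖ ≤ ‖x - y k‖

section DiameterTwo

variable {X : Type*} [NormedAddCommGroup X] [NormedSpace ℝ X]

theorem tendsto_toWeakSpace {κ : Type*} {l : Filter κ} {y : κ → X} {x : X}
    (h : ∀ f : StrongDual ℝ X, Tendsto (fun k => f (y k)) l (𝓝 (f x))) :
    Tendsto (fun k => toWeakSpace ℝ X (y k)) l (𝓝 (toWeakSpace ℝ X x)) := by
  have hind : IsInducing fun (z : WeakSpace ℝ X) (f : StrongDual ℝ X) =>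
      (topDualPairing ℝ X).flip z f := ⟨rfl⟩
  exact hind.tendsto_nhds_iff.2 (tendsto_pi_nhds.2 h)

theorem HasSeqDD2P.hasLD2PPlus (h : HasSeqDD2P X) : HasLD2PPlus X := by
  intro f _ ε _ δ hδ x hx hx1
  obtain ⟨y, hy, hyf, hfar⟩ := h x (2 - δ / 2) (by linarith)
  obtain ⟨k, hk⟩ := ((hyf f).eventually_const_lt hx.2).exists
  refine ⟨y k, ⟨mem_closedBall_zero_iff.2 (hx1 ▸ hy k), hk⟩, ?_⟩
  have hk_far := hfar k
  rw [hx1] at hk_far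
  linarith

theorem exists_norm_add_smul_eq_one {x v : X} (hx : ‖x‖ ≤ 1) (hv : 1 ≤ ‖v‖) :
    ∃ t ∈ Icc (0 : ℝ) 2, ‖x + t • v‖ = 1 := by
  have hcont : ContinuousOn (fun t : ℝ => ‖x + t • v‖) (Icc 0 2) := by fun_prop
  have htwo : 1 ≤ ‖x + (2 : ℝ) • v‖ := by
    have h := norm_sub_le_norm_add ((2 : ℝ) • v) x
    rw [norm_smul, Real.norm_ofNat, add_comm] at h
    linarith
  exact intermediate_value_Icc two_pos.le hcont ⟨by simpa using hx, htwo⟩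

theorem HasSeqDD2P.exists_norm_eq_one_of_isOpen [Nontrivial X] (h : HasSeqDD2P X)
    {U : Set (WeakSpace ℝ X)} (hU : IsOpen U) {x : X} (hx : ‖x‖ ≤ 1)
    (hxU : toWeakSpace ℝ X x ∈ U) : ∃ z : X, ‖z‖ = 1 ∧ toWeakSpace ℝ X z ∈ U := by
  obtain ⟨e, he⟩ := exists_norm_eq X zero_le_one
  obtain ⟨y, -, hyf, hfar⟩ := h e 1 one_lt_two
  have hv : ∀ k, 1 ≤ ‖y k - e‖ := fun k => by simpa [he, norm_sub_rev] using hfar k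
  choose t ht ht1 using fun k => exists_norm_add_smul_eq_one hx (hv k)
  have hlim : Tendsto (fun k => toWeakSpace ℝ X (x + t k • (y k - e))) atTop
      (𝓝 (toWeakSpace ℝ X x)) := by
    refine tendsto_toWeakSpace fun f => ?_
    have hdiff : Tendsto (fun k => f (y k - e)) atTop (𝓝 0) := by
      simpa only [map_sub, sub_self] using (hyf f).sub_const (f e)
    have hmul : Tendsto (fun k => t k * f (y k - e)) atTop (𝓝 0) :=
      bdd_le_mul_tendsto_zero (Eventually.of_forall fun k => (ht k).1)
        (Eventually.of_forall fun k => (ht k).2) hdiff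
    simpa only [map_add, map_smul, smul_eq_mul, add_zero] using hmul.const_add (f x)
  obtain ⟨k, hk⟩ := (hlim.eventually (hU.mem_nhds hxU)).exists
  exact ⟨_, ht1 k, hk⟩

theorem HasSeqDD2P.hasD2P [Nontrivial X] (h : HasSeqDD2P X) : HasD2P X := by
  rintro U hU ⟨x₀, hx₀, hx₀U⟩
  obtain ⟨x, hx, hxU⟩ := h.exists_norm_eq_one_of_isOpen hU (mem_closedBall_zero_iff.1 hx₀) hx₀U
  refine le_antisymm ?_ (le_of_forall_lt fun c hc => ?_)
  · exact Metric.diam_le_of_subset_closedBall zero_le_one inter_subset_left |>.trans_eq (mul_one 2)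
  · obtain ⟨c', hcc', hc'⟩ := exists_between hc
    obtain ⟨y, hy, hyf, hfar⟩ := h x c' hc'
    obtain ⟨k, hk⟩ := ((tendsto_toWeakSpace hyf).eventually (hU.mem_nhds hxU)).exists
    have hdist : dist x (y k) ≤ Metric.diam (Metric.closedBall 0 1 ∩ toWeakSpace ℝ X ⁻¹' U) :=
      Metric.dist_le_diam_of_mem (Metric.isBounded_closedBall.subset inter_subset_left)
        ⟨mem_closedBall_zero_iff.2 hx.le, hxU⟩ ⟨mem_closedBall_zero_iff.2 (hx ▸ hy k), hk⟩
    have hk_far := hfar k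
    rw [hx, mul_one, ← dist_eq_norm] at hk_far
    linarith

end DiameterTwo

section LpTwo

variable {ι : Type*} [DecidableEq ι] {E : ι → Type*} [∀ i, NormedAddCommGroup (E i)]

theorem mul_norm_sum_single_lp_two_le {F : Finset ι} {v v' : ∀ i, E i} {c : ℝ} (hc : 0 ≤ c)
    (h : ∀ i ∈ F, c * ‖v i‖ ≤ ‖v' i‖) :
    c * ‖∑ i ∈ F, (lp.single 2 i (v i) : lp E 2)‖ ≤ ‖∑ i ∈ F, (lp.single 2 i (v' i) : lp E 2)‖ := by
  refine le_of_sq_le_sq ?_ (norm_nonneg _)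
  rw [mul_pow, sq_norm_sum_single_lp_two, sq_norm_sum_single_lp_two, Finset.mul_sum]
  refine Finset.sum_le_sum fun i hi => ?_
  rw [← mul_pow]
  exact pow_le_pow_left₀ (mul_nonneg hc (norm_nonneg _)) (h i hi) 2

variable [∀ i, NormedSpace ℝ (E i)]

theorem tendsto_apply_add_sum_single {κ : Type*} {l : Filter κ} {x : lp E 2} {F : Finset ι}
    {z : ∀ i, κ → E i}
    (hz : ∀ i, ∀ g : StrongDual ℝ (E i), Tendsto (fun k => g (z i k)) l (𝓝 (g (x i))))
    (f : StrongDual ℝ (lp E 2)) :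
    Tendsto (fun k => f (x + ∑ i ∈ F, lp.single 2 i (z i k - x i))) l (𝓝 (f x)) := by
  have hi : ∀ i, Tendsto (fun k => f (lp.single 2 i (z i k - x i))) l (𝓝 0) := fun i => by
    let g : StrongDual ℝ (E i) := f.comp (lp.singleContinuousLinearMap ℝ E 2 i)
    have h : Tendsto (fun k => g (z i k - x i)) l (𝓝 0) := by
      simpa only [map_sub, sub_self] using (hz i g).sub_const (g (x i))
    exact h
  have hsum := (tendsto_finsetSum F fun i _ => hi i).const_add (f x)
  simpa only [map_add, map_sum, Finset.sum_const_zero, add_zero] using hsum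

end LpTwo

theorem HasSeqDD2P.lp_two {ι : Type*} {E : ι → Type*} [∀ i, NormedAddCommGroup (E i)]
    [∀ i, NormedSpace ℝ (E i)] (hE : ∀ i, HasSeqDD2P (E i)) : HasSeqDD2P (lp E 2) := by
  classical
  intro x c hc
  rcases eq_or_ne x 0 with rfl | hx
  · exact ⟨fun _ => 0, fun _ => le_rfl, fun _ => tendsto_const_nhds, fun _ => by simp⟩
  obtain ⟨c', hcc', hc'⟩ := exists_between (max_lt hc two_pos)
  obtain ⟨hcc', hc'0⟩ := max_lt_iff.1 hcc'
  obtain ⟨F, hF⟩ : ∃ F : Finset ι, c * ‖x‖ < c' * ‖∑ i ∈ F, (lp.single 2 i (x i) : lp E 2)‖ :=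
    (((lp.hasSum_single (by norm_num) x).norm.const_mul c').eventually_const_lt
      (mul_lt_mul_of_pos_right hcc' (norm_pos_iff.2 hx))).exists
  choose z hzx hzf hfar using fun i => hE i (x i) c' hc'
  refine ⟨fun k => x + ∑ i ∈ F, lp.single 2 i (z i k - x i), fun k => ?_,
    tendsto_apply_add_sum_single hzf, fun k => ?_⟩
  · refine norm_lp_two_le_of_forall_le fun i => ?_
    rw [lp.coeFn_add, Pi.add_apply, sum_single_lp_two_apply (fun i => z i k - x i)]
    split_ifs
    · simpa only [add_sub_cancel] using hzx i k
    · rw [add_zero]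
  · rw [sub_add_cancel_left, norm_neg]
    refine hF.le.trans (mul_norm_sum_single_lp_two_le hc'0.le fun i _ => ?_)
    rw [norm_sub_rev]
    exact hfar i k

/-! ### Oscillating multipliers -/

theorem tendsto_zero_of_bounded_signed_sums {V : Type*} [SeminormedAddCommGroup V]
    [NormedSpace ℝ V] {v : ℕ → V} {C : ℝ}
    (hv : ∀ (F : Finset ℕ) (σ : ℕ → ℝ), (∀ k, |σ k| ≤ 1) → ‖∑ k ∈ F, σ k • v k‖ ≤ C)
    (f : StrongDual ℝ V) : Tendsto (fun k => f (v k)) atTop (𝓝 0) := by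
  have hsum : Summable fun k => |f (v k)| := by
    refine summable_of_sum_le (c := ‖f‖ * C) (fun k => abs_nonneg _) fun F => ?_
    have hsign : ∑ k ∈ F, |f (v k)| = f (∑ k ∈ F, (SignType.sign (f (v k)) : ℝ) • v k) := by
      simp only [map_sum, map_smul, smul_eq_mul, sign_mul_self]
    rw [hsign]
    refine (le_abs_self _).trans ((f.le_opNorm _).trans ?_)
    refine mul_le_mul_of_nonneg_left (hv F _ fun k => ?_) (norm_nonneg _)
    rcases SignType.trichotomy (SignType.sign (f (v k))) with h | h | h <;> simp [h]
  exact (tendsto_zero_iff_abs_tendsto_zero _).2 hsum.tendsto_atTop_zero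

theorem abs_sum_mul_le_one_of_disjoint_support {α κ : Type*} {g : κ → α → ℝ}
    (hdisj : Pairwise (Function.onFun Disjoint fun k => Function.support (g k)))
    (hg : ∀ k a, |g k a| ≤ 1) {σ : κ → ℝ} (hσ : ∀ k, |σ k| ≤ 1) (F : Finset κ) (a : α) :
    |∑ k ∈ F, σ k * g k a| ≤ 1 := by
  by_cases h : ∃ j ∈ F, g j a ≠ 0
  · obtain ⟨j, hj, hja⟩ := h
    rw [Finset.sum_eq_single_of_mem j hj fun k _ hkj => ?_, abs_mul]
    · exact mul_le_one₀ (hσ j) (abs_nonneg _) (hg j a)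
    · rw [Function.notMem_support.1 (disjoint_right.1 (hdisj hkj) hja), mul_zero]
  · push Not at h
    rw [Finset.sum_eq_zero fun k hk => by rw [h k hk, mul_zero], abs_zero]
    exact zero_le_one

/-- A tent of height `1` on the line centred at `2⁻ᵏ`. Its support has radius `2⁻ᵏ / 4`, which
makes the supports for different `k` disjoint. -/
noncomputable def dyadicTent (k : ℕ) (v : ℝ) : ℝ :=
  max 0 (1 - 4 * 2 ^ k * |v - (1 / 2) ^ k|)

theorem dyadicTent_nonneg (k : ℕ) (v : ℝ) : 0 ≤ dyadicTent k v := le_max_left _ _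

theorem dyadicTent_le_one (k : ℕ) (v : ℝ) : dyadicTent k v ≤ 1 :=
  max_le zero_le_one (sub_le_self _ (by positivity))

theorem dyadicTent_half_pow (k : ℕ) : dyadicTent k ((1 / 2) ^ k) = 1 := by
  simp [dyadicTent]

theorem support_dyadicTent_subset (k : ℕ) :
    Function.support (dyadicTent k) ⊆ Metric.ball ((1 / 2) ^ k) ((1 / 2) ^ k / 4) := by
  intro v hv
  rw [Metric.mem_ball, Real.dist_eq]
  by_contra! hfar
  refine hv (max_eq_left (sub_nonpos.2 ?_))
  calc (1 : ℝ) = 4 * 2 ^ k * ((1 / 2) ^ k / 4) := by rw [one_div_pow]; field_simp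
    _ ≤ 4 * 2 ^ k * |v - (1 / 2) ^ k| := by gcongr

theorem pairwise_disjoint_support_dyadicTent :
    Pairwise (Function.onFun Disjoint fun k => Function.support (dyadicTent k)) := by
  refine (pairwise_disjoint_on _).2 fun j k hjk => Disjoint.mono
    (support_dyadicTent_subset j) (support_dyadicTent_subset k) (Metric.ball_disjoint_ball ?_)
  have hpow : (1 / 2 : ℝ) ^ k ≤ (1 / 2) ^ j / 2 := by
    calc (1 / 2 : ℝ) ^ k ≤ (1 / 2) ^ (j + 1) :=
          pow_le_pow_of_le_one (by norm_num) (by norm_num) hjk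
      _ = (1 / 2) ^ j / 2 := by ring
  have hpos : (0 : ℝ) < (1 / 2) ^ j := by positivity
  rw [Real.dist_eq]
  linarith [le_abs_self ((1 / 2 : ℝ) ^ j - (1 / 2) ^ k)]

/-- The `k`-th tent evaluated along the oscillation `s ↦ sin (M s)`: the multiplier `φ k` that makes
`φ k * x` weakly null in `X_D`. -/
noncomputable def sinTent (M : ℝ) (k : ℕ) : C(unitInterval, ℝ) where
  toFun s := dyadicTent k (Real.sin (M * s))
  continuous_toFun := by unfold dyadicTent; fun_prop

theorem sinTent_apply (M : ℝ) (k : ℕ) (s : unitInterval) :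
    sinTent M k s = dyadicTent k (Real.sin (M * s)) :=
  rfl

theorem abs_one_sub_two_smul_sinTent_le_one (M : ℝ) (k : ℕ) (s : unitInterval) :
    |(1 - (2 : ℝ) • sinTent M k) s| ≤ 1 := by
  have := dyadicTent_nonneg k (Real.sin (M * s))
  have := dyadicTent_le_one k (Real.sin (M * s))
  rw [ContinuousMap.sub_apply, ContinuousMap.one_apply, ContinuousMap.smul_apply, smul_eq_mul,
    sinTent_apply, abs_le]
  constructor <;> linarith

theorem abs_sum_smul_sinTent_le_one (M : ℝ) {σ : ℕ → ℝ} (hσ : ∀ k, |σ k| ≤ 1) (F : Finset ℕ)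
    (s : unitInterval) : |(∑ k ∈ F, σ k • sinTent M k) s| ≤ 1 := by
  simp only [ContinuousMap.sum_apply, ContinuousMap.smul_apply, smul_eq_mul, sinTent_apply]
  exact abs_sum_mul_le_one_of_disjoint_support pairwise_disjoint_support_dyadicTent
    (fun k v => (abs_of_nonneg (dyadicTent_nonneg k v)).trans_le (dyadicTent_le_one k v)) hσ F _

theorem exists_mem_Ico_sin_mul_eq {a b M v : ℝ} (hM : 0 < M) (hab : 2 * Real.pi ≤ M * (b - a))
    (hv : v ∈ Icc (-1) 1) : ∃ s ∈ Ico a b, Real.sin (M * s) = v := by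
  obtain ⟨y, ⟨hay, hyb⟩, hy⟩ :=
    Real.sin_periodic.exists_mem_Ico Real.two_pi_pos (Real.arcsin v) (M * a)
  refine ⟨y / M, ⟨(le_div_iff₀' hM).2 hay, (div_lt_iff₀' hM).2 (by linarith)⟩, ?_⟩
  rw [mul_div_cancel₀ _ hM.ne', ← hy, Real.sin_arcsin hv.1 hv.2]

theorem eventually_exists_sin_mul_eq {V : Set unitInterval} (hV : IsOpen V) (hne : V.Nonempty) :
    ∀ᶠ M : ℝ in atTop, ∀ v ∈ Icc (-1 : ℝ) 1, ∃ s ∈ V, Real.sin (M * s) = v := by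
  obtain ⟨a, b, hab, habV⟩ := hV.exists_Ioo_subset hne
  obtain ⟨c, hac, hcb⟩ := exists_between (Subtype.coe_lt_coe.2 hab)
  have hlarge : Tendsto (fun M : ℝ => M * (b - c)) atTop atTop :=
    tendsto_id.atTop_mul_const (sub_pos.2 hcb)
  filter_upwards [eventually_gt_atTop 0, hlarge.eventually_ge_atTop (2 * Real.pi)]
    with M hM hMbc v hv
  obtain ⟨s, ⟨hcs, hsb⟩, hs⟩ := exists_mem_Ico_sin_mul_eq hM hMbc hv
  have has : (a : ℝ) < s := hac.trans_le hcs
  exact ⟨⟨s, a.2.1.trans has.le, hsb.le.trans b.2.2⟩, habV ⟨has, hsb⟩, hs⟩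

/-- The multipliers `φ a` are bounded by `1` and, along the filter `l`, take the value `1` on every
non-empty open set, so that multiplication by `φ a` asymptotically preserves suprema over open
sets. -/
structure IsNormingAlong {α : Type*} (l : Filter α) (φ : α → C(unitInterval, ℝ)) : Prop where
  abs_le_one : ∀ a s, |φ a s| ≤ 1
  eventually_exists_eq_one : ∀ V : Set unitInterval, IsOpen V → V.Nonempty →
    ∀ᶠ a in l, ∃ s ∈ V, φ a s = 1

theorem isNormingAlong_sinTent :
    IsNormingAlong (comap Prod.fst atTop) fun q : ℝ × ℕ => sinTent q.1 q.2 where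
  abs_le_one q s :=
    (abs_of_nonneg (dyadicTent_nonneg _ _)).trans_le (dyadicTent_le_one q.2 (Real.sin (q.1 * s)))
  eventually_exists_eq_one V hV hne := by
    filter_upwards [tendsto_comap.eventually (eventually_exists_sin_mul_eq hV hne)] with q hq
    obtain ⟨s, hsV, hs⟩ := hq ((1 / 2) ^ q.2)
      ⟨neg_one_lt_zero.le.trans (by positivity), pow_le_one₀ (by norm_num) (by norm_num)⟩
    exact ⟨s, hsV, by rw [sinTent_apply, hs, dyadicTent_half_pow]⟩

namespace IsNormingAlong

variable {α : Type*} {l : Filter α} {φ : α → C(unitInterval, ℝ)}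

theorem tendsto_supOn_mul (hφ : IsNormingAlong l φ) {A : Set unitInterval} (hA : IsOpen A)
    (hne : A.Nonempty) (x : C(unitInterval, ℝ)) :
    Tendsto (fun a => supOn A (φ a * x)) l (𝓝 (supOn A x)) := by
  refine tendsto_order.2 ⟨fun c hc => ?_, fun c hc => Eventually.of_forall fun a =>
    (supOn_mul_le A (hφ.abs_le_one a) x).trans_lt hc⟩
  have := hne.to_subtype
  obtain ⟨t, ht⟩ := exists_lt_of_lt_ciSup hc
  have hV : IsOpen (A ∩ {s | c < |x s|}) :=
    hA.inter (isOpen_lt continuous_const (by fun_prop))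
  filter_upwards [hφ.eventually_exists_eq_one _ hV ⟨t, t.2, ht⟩] with a ⟨s, hs, hs1⟩
  have hle := le_supOn (φ a * x) hs.1
  rw [ContinuousMap.mul_apply, hs1, one_mul] at hle
  exact lt_of_lt_of_le hs.2 hle

theorem tendsto_dNorm_mul [l.IsCountablyGenerated] (hφ : IsNormingAlong l φ) (D : NbhdBase)
    (x : C(unitInterval, ℝ)) : Tendsto (fun a => dNorm D (φ a * x)) l (𝓝 (dNorm D x)) := by
  refine (Real.continuous_sqrt.tendsto _).comp <| tendsto_tsum_of_dominated_convergence
    (dNorm_summable D x)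
    (fun n => ((hφ.tendsto_supOn_mul (D.isOpen_sets n) (D.nonempty n) x).pow 2).const_mul _)
    (Eventually.of_forall fun a n => ?_)
  have := supOn_nonneg (D.sets n) (φ a * x)
  rw [Real.norm_of_nonneg (by positivity)]
  gcongr
  exact supOn_mul_le _ (hφ.abs_le_one a) x

end IsNormingAlong

theorem exists_mul_le_dNorm_sinTent_mul (D : NbhdBase) (x : C(unitInterval, ℝ)) {c : ℝ}
    (hc : c < 1) : ∃ M : ℝ, ∀ k, c * dNorm D x ≤ dNorm D (sinTent M k * x) := by
  rcases (dNorm_nonneg D x).eq_or_lt with h0 | hpos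
  · exact ⟨0, fun k => by rw [← h0, mul_zero]; exact dNorm_nonneg D _⟩
  · obtain ⟨M, hM⟩ := (eventually_comap.1 ((isNormingAlong_sinTent.tendsto_dNorm_mul D x)
      |>.eventually_const_lt (mul_lt_of_lt_one_left hpos hc))).exists
    exact ⟨M, fun k => (hM (M, k) rfl).le⟩

theorem XSpace.tendsto_apply_sinTent_mul {D : NbhdBase} (M : ℝ) (x : C(unitInterval, ℝ))
    (f : StrongDual ℝ (XSpace D)) :
    Tendsto (fun k => f ((XSpace.equiv D).symm (sinTent M k * x))) atTop (𝓝 0) := by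
  refine tendsto_zero_of_bounded_signed_sums (C := dNorm D x) (fun F σ hσ => ?_) f
  have hsum : ∑ k ∈ F, σ k • (XSpace.equiv D).symm (sinTent M k * x) =
      (XSpace.equiv D).symm ((∑ k ∈ F, σ k • sinTent M k) * x) := by
    simp only [Finset.sum_mul, map_sum, smul_mul_assoc, map_smul]
  rw [hsum, XSpace.norm_equiv_symm]
  exact dNorm_mul_le D (abs_sum_smul_sinTent_le_one M hσ F) x

theorem XSpace.hasSeqDD2P (D : NbhdBase) : HasSeqDD2P (XSpace D) := by
  intro x c hc
  obtain ⟨M, hM⟩ := exists_mul_le_dNorm_sinTent_mul D (XSpace.equiv D x) (c := c / 2) (by linarith)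
  let v : ℕ → XSpace D := fun k => (XSpace.equiv D).symm (sinTent M k * XSpace.equiv D x)
  refine ⟨fun k => x - (2 : ℝ) • v k, fun k => ?_, fun f => ?_, fun k => ?_⟩
  · have hmul : XSpace.equiv D (x - (2 : ℝ) • v k) =
        (1 - (2 : ℝ) • sinTent M k) * XSpace.equiv D x := by
      simp only [v, map_sub, map_smul, LinearEquiv.apply_symm_apply, sub_mul, one_mul,
        smul_mul_assoc]
    rw [XSpace.norm_eq_dNorm, hmul, XSpace.norm_eq_dNorm]
    exact dNorm_mul_le D (abs_one_sub_two_smul_sinTent_le_one M k) _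
  · simpa only [map_sub, map_smul, smul_zero, sub_zero] using
      ((XSpace.tendsto_apply_sinTent_mul M _ f).const_smul (2 : ℝ)).const_sub (f x)
  · rw [sub_sub_cancel, norm_smul, Real.norm_ofNat, XSpace.norm_equiv_symm, XSpace.norm_eq_dNorm]
    linarith [hM k]

/-! ### Convex combinations of slices -/

/-- Convex combinations of slices of the unit ball get arbitrarily small in diameter; this is a
strong failure of the strong diameter 2 property. -/
def HasSmallSliceCombs (X : Type*) [NormedAddCommGroup X] [NormedSpace ℝ X] : Prop :=
  ∀ r : ℝ, 0 < r → ∃ C : Set X, IsConvexCombOfSlices C ∧ Metric.diam C < r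

theorem IsConvexCombOfSlices.subset_closedBall {X : Type*} [NormedAddCommGroup X]
    [NormedSpace ℝ X] {C : Set X} (hC : IsConvexCombOfSlices C) : C ⊆ Metric.closedBall 0 1 := by
  obtain ⟨m, c, f, ε, hc, hc1, -, -, rfl⟩ := hC
  rintro _ ⟨x, hx, rfl⟩
  exact (convex_closedBall 0 1).sum_mem (fun j _ => hc j) hc1 fun j _ => (hx j).1

section LpTwo

variable {ι : Type*} {E : ι → Type*} [∀ i, NormedAddCommGroup (E i)] [∀ i, NormedSpace ℝ (E i)]

theorem norm_comp_evalCLM_lp_two (i : ι) (f : StrongDual ℝ (E i)) :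
    ‖f.comp (lp.evalCLM ℝ E 2 i)‖ = ‖f‖ := by
  classical
  refine le_antisymm ?_ ?_
  · refine ContinuousLinearMap.opNorm_le_bound _ (norm_nonneg f) fun x => ?_
    exact (f.le_opNorm _).trans <|
      mul_le_mul_of_nonneg_left (lp.norm_apply_le_norm two_ne_zero x i) (norm_nonneg f)
  · refine ContinuousLinearMap.opNorm_le_bound _ (norm_nonneg _) fun v => ?_
    have h := (f.comp (lp.evalCLM ℝ E 2 i)).le_opNorm (lp.single 2 i v)
    have happly : f.comp (lp.evalCLM ℝ E 2 i) (lp.single 2 i v) = f v :=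
      congrArg f (lp.single_apply_self 2 i v)
    rwa [lp.norm_single (by norm_num), happly] at h

variable [DecidableEq ι] {i : ι}

theorem sq_norm_sub_single_le_of_mem_ballSlice {f : StrongDual ℝ (E i)} (hf : ‖f‖ ≤ 1) {η : ℝ}
    {x : lp E 2} (hx : x ∈ ballSlice (f.comp (lp.evalCLM ℝ E 2 i)) η) :
    ‖x - lp.single 2 i (x i)‖ ^ 2 ≤ 2 * η := by
  have hball : ‖x‖ ^ 2 ≤ 1 := pow_le_one₀ (norm_nonneg x) (mem_closedBall_zero_iff.1 hx.1)
  have hcoord : 1 - η < ‖x i‖ :=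
    hx.2.trans_le <| (le_abs_self _).trans <| (f.le_of_opNorm_le hf (x i)).trans_eq (one_mul _)
  rw [sq_norm_sub_single_lp_two]
  linarith [sq_nonneg (‖x i‖ - 1)]

theorem IsConvexCombOfSlices.exists_lp_two (i : ι) {C : Set (E i)} (hC : IsConvexCombOfSlices C)
    {ρ : ℝ} (hρ : 0 < ρ) : ∃ C' : Set (lp E 2), IsConvexCombOfSlices C' ∧
      ∀ z ∈ C', z i ∈ C ∧ ‖z - lp.single 2 i (z i)‖ ≤ ρ := by
  obtain ⟨m, c, f, ε, hc, hc1, hf, hε, rfl⟩ := hC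
  refine ⟨_, ⟨m, c, fun j => (f j).comp (lp.evalCLM ℝ E 2 i), fun j => min (ε j) (ρ ^ 2 / 2), hc,
    hc1, fun j => (norm_comp_evalCLM_lp_two i (f j)).trans (hf j),
    fun j => lt_min (hε j) (by positivity), rfl⟩, ?_⟩
  rintro _ ⟨x, hx, rfl⟩
  refine ⟨⟨fun j => x j i, fun j => ⟨?_, ?_⟩, map_sum (lp.evalCLM ℝ E 2 i) _ _⟩, ?_⟩
  · exact mem_closedBall_zero_iff.2 <|
      (lp.norm_apply_le_norm two_ne_zero (x j) i).trans (mem_closedBall_zero_iff.1 (hx j).1)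
  · exact (sub_le_sub_left (min_le_left _ _) 1).trans_lt (hx j).2
  · let T : lp E 2 →L[ℝ] lp E 2 := .id ℝ _ -
      (lp.singleContinuousLinearMap ℝ E 2 i).comp (lp.evalCLM ℝ E 2 i)
    have hT : ∀ j, ‖T (x j)‖ ≤ ρ := fun j => le_of_sq_le_sq
      ((sq_norm_sub_single_le_of_mem_ballSlice (hf j).le (hx j)).trans
        (by linarith [min_le_right (ε j) (ρ ^ 2 / 2)])) hρ.le
    have hsum : T (∑ j, c j • x j) ∈ Metric.closedBall 0 ρ := by
      simp only [map_sum, map_smul]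
      exact (convex_closedBall 0 ρ).sum_mem (fun j _ => hc j) hc1
        fun j _ => mem_closedBall_zero_iff.2 (hT j)
    exact mem_closedBall_zero_iff.1 hsum

end LpTwo

theorem HasSmallSliceCombs.lp_two {ι : Type*} {E : ι → Type*} [∀ i, NormedAddCommGroup (E i)]
    [∀ i, NormedSpace ℝ (E i)] {i : ι} (hE : HasSmallSliceCombs (E i)) :
    HasSmallSliceCombs (lp E 2) := by
  classical
  intro r hr
  obtain ⟨C, hC, hCr⟩ := hE r hr
  obtain ⟨C', hC', hC'C⟩ := hC.exists_lp_two i (ρ := (r - Metric.diam C) / 3) (by linarith)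
  have hbdd := Metric.isBounded_closedBall.subset hC.subset_closedBall
  refine ⟨C', hC', (Metric.diam_le_of_forall_dist_le
    (C := Metric.diam C + 2 * ((r - Metric.diam C) / 3)) (by positivity)
    fun y hy z hz => ?_).trans_lt (by linarith)⟩
  obtain ⟨hyC, hyi⟩ := hC'C y hy
  obtain ⟨hzC, hzi⟩ := hC'C z hz
  have hyz : dist (lp.single 2 i (y i) : lp E 2) (lp.single 2 i (z i)) ≤ Metric.diam C := by
    rw [dist_eq_norm, ← lp.single_sub, lp.norm_single (by norm_num), ← dist_eq_norm]
    exact Metric.dist_le_diam_of_mem hbdd hyC hzC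
  rw [← dist_eq_norm] at hyi hzi
  rw [dist_comm] at hzi
  linarith [dist_triangle4 y (lp.single 2 i (y i)) (lp.single 2 i (z i)) z]

/-! ### Thin slices at point evaluations -/

theorem half_pow_mul_sq_supOn_le (D : NbhdBase) (x : C(unitInterval, ℝ)) (n : ℕ) :
    (1 / 2 : ℝ) ^ (n + 1) * supOn (D.sets n) x ^ 2 ≤ dNorm D x ^ 2 :=
  le_hasSum (hasSum_sq_dNorm D x) n fun _ _ => by positivity

theorem exists_abs_apply_le_mul_dNorm (D : NbhdBase) (t : unitInterval) :
    ∃ C : ℝ, ∀ x : C(unitInterval, ℝ), |x t| ≤ C * dNorm D x := by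
  obtain ⟨n, ht, -⟩ := D.exists_mem_subset (t := t) univ_mem
  refine ⟨√(2 ^ (n + 1)), fun x => (le_supOn x ht).trans ?_⟩
  refine le_of_sq_le_sq ?_ (mul_nonneg (Real.sqrt_nonneg _) (dNorm_nonneg D x))
  have h := half_pow_mul_sq_supOn_le D x n
  rwa [one_div_pow, one_div, inv_mul_le_iff₀ (by positivity),
    ← Real.sq_sqrt (show (0 : ℝ) ≤ 2 ^ (n + 1) by positivity), ← mul_pow] at h

/-- Evaluation at the point `t`, as a functional on `X_D`. -/
noncomputable def XSpace.eval (D : NbhdBase) (t : unitInterval) : StrongDual ℝ (XSpace D) :=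
  LinearMap.mkContinuousOfExistsBound
    { toFun := fun x => XSpace.equiv D x t
      map_add' := fun _ _ => rfl
      map_smul' := fun _ _ => rfl }
    (exists_abs_apply_le_mul_dNorm D t)

theorem XSpace.eval_apply {D : NbhdBase} {t : unitInterval} (x : XSpace D) :
    XSpace.eval D t x = XSpace.equiv D x t :=
  rfl

theorem XSpace.eval_ne_zero (D : NbhdBase) (t : unitInterval) : XSpace.eval D t ≠ 0 := fun h =>
  one_ne_zero (α := ℝ) (DFunLike.congr_fun h ((XSpace.equiv D).symm 1))

/-- The point evaluation `XSpace.eval D t`, normalized to have norm `1`. -/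
noncomputable def XSpace.unitEval (D : NbhdBase) (t : unitInterval) : StrongDual ℝ (XSpace D) :=
  ‖XSpace.eval D t‖⁻¹ • XSpace.eval D t

theorem XSpace.norm_unitEval (D : NbhdBase) (t : unitInterval) : ‖XSpace.unitEval D t‖ = 1 :=
  norm_smul_inv_norm (𝕜 := ℝ) (XSpace.eval_ne_zero D t)

section ThinSlices

variable {D : NbhdBase} {t : unitInterval} {η : ℝ} {x : XSpace D} {φ : C(unitInterval, ℝ)}

theorem lt_dNorm_mul_of_mem_ballSlice (hx : x ∈ ballSlice (XSpace.unitEval D t) η)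
    (hφ : φ t = 1) : 1 - η < dNorm D (φ * XSpace.equiv D x) := by
  have heval : XSpace.unitEval D t ((XSpace.equiv D).symm (φ * XSpace.equiv D x)) =
      XSpace.unitEval D t x := by
    simp only [XSpace.unitEval, smul_apply, XSpace.eval_apply,
      LinearEquiv.apply_symm_apply, ContinuousMap.mul_apply, hφ, one_mul]
  have hnorm := (XSpace.unitEval D t).le_opNorm ((XSpace.equiv D).symm (φ * XSpace.equiv D x))
  rw [XSpace.norm_unitEval, one_mul, heval, XSpace.norm_equiv_symm] at hnorm
  exact hx.2.trans_le ((le_abs_self _).trans hnorm)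

theorem sq_dNorm_mul_add_le (D : NbhdBase) (hφ : ∀ s, |φ s| ≤ 1) {n : ℕ}
    (hn : ∀ s ∈ D.sets n, φ s = 0) (x : C(unitInterval, ℝ)) :
    dNorm D (φ * x) ^ 2 + (1 / 2 : ℝ) ^ (n + 1) * supOn (D.sets n) x ^ 2 ≤ dNorm D x ^ 2 := by
  refine hasSum_le (fun k => ?_) ((hasSum_sq_dNorm D (φ * x)).add
    (hasSum_ite_eq n ((1 / 2 : ℝ) ^ (n + 1) * supOn (D.sets n) x ^ 2))) (hasSum_sq_dNorm D x)
  split_ifs with hk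
  · subst hk
    have hzero : supOn (D.sets k) (φ * x) = 0 :=
      le_antisymm (supOn_le le_rfl fun s hs => by
        rw [ContinuousMap.mul_apply, hn s hs, zero_mul, abs_zero]) (supOn_nonneg _ _)
    rw [hzero, zero_pow two_ne_zero, mul_zero, zero_add]
  · have := supOn_nonneg (D.sets k) (φ * x)
    rw [add_zero]
    gcongr
    exact supOn_mul_le _ hφ x

theorem half_pow_mul_sq_supOn_le_of_mem_ballSlice (hx : x ∈ ballSlice (XSpace.unitEval D t) η)
    (hφt : φ t = 1) (hφ : ∀ s, |φ s| ≤ 1) {n : ℕ} (hn : ∀ s ∈ D.sets n, φ s = 0) :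
    (1 / 2 : ℝ) ^ (n + 1) * supOn (D.sets n) (XSpace.equiv D x) ^ 2 ≤ 2 * η := by
  have hball : dNorm D (XSpace.equiv D x) ^ 2 ≤ 1 :=
    pow_le_one₀ (dNorm_nonneg D _) (mem_closedBall_zero_iff.1 hx.1)
  linarith [lt_dNorm_mul_of_mem_ballSlice hx hφt, sq_dNorm_mul_add_le D hφ hn (XSpace.equiv D x),
    sq_nonneg (dNorm D (φ * XSpace.equiv D x) - 1)]

theorem NbhdBase.exists_forall_mem_sets_subset (D : NbhdBase) {K U : Set unitInterval}
    (hK : IsCompact K) (hU : IsOpen U) (hKU : K ⊆ U) :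
    ∃ N, ∀ s ∈ K, ∃ n ≤ N, s ∈ D.sets n ∧ D.sets n ⊆ U := by
  refine hK.induction_on (p := fun S => ∃ N, ∀ s ∈ S, ∃ n ≤ N, s ∈ D.sets n ∧ D.sets n ⊆ U)
    ⟨0, fun s hs => hs.elim⟩ (fun _ _ hST ⟨N, hN⟩ => ⟨N, fun s hs => hN s (hST hs)⟩) ?_ ?_
  · rintro S T ⟨N, hN⟩ ⟨M, hM⟩
    refine ⟨max N M, fun s hs => ?_⟩
    rcases hs with hs | hs
    · exact (hN s hs).imp fun n hn => ⟨hn.1.trans (le_max_left N M), hn.2⟩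
    · exact (hM s hs).imp fun n hn => ⟨hn.1.trans (le_max_right N M), hn.2⟩
  · intro s hs
    obtain ⟨n, hsn, hnU⟩ := D.exists_mem_subset (hU.mem_nhds (hKU hs))
    exact ⟨D.sets n, mem_nhdsWithin_of_mem_nhds ((D.isOpen_sets n).mem_nhds hsn), n,
      fun s' hs' => ⟨n, le_rfl, hs', hnU⟩⟩

theorem XSpace.exists_ballSlice_abs_le (D : NbhdBase) {V : Set unitInterval} (hV : IsOpen V)
    (ht : t ∈ V) {ρ : ℝ} (hρ : 0 < ρ) :
    ∃ η : ℝ, 0 < η ∧ ∀ x ∈ ballSlice (XSpace.unitEval D t) η, ∀ s ∉ V,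
      |XSpace.equiv D x s| ≤ ρ := by
  obtain ⟨W, hWt, hW, hWV⟩ := exists_mem_nhds_isClosed_subset (hV.mem_nhds ht)
  obtain ⟨φ, hφW, hφt, hφ01⟩ := exists_continuous_zero_one_of_isClosed
    (isOpen_interior (s := W)).isClosed_compl (isClosed_singleton (x := t))
    (disjoint_singleton_right.2 (not_not.2 (mem_interior_iff_mem_nhds.2 hWt)))
  obtain ⟨N, hN⟩ := D.exists_forall_mem_sets_subset hV.isClosed_compl.isCompact hW.isOpen_compl
    (compl_subset_compl.2 hWV)
  refine ⟨(1 / 2) ^ (N + 1) * ρ ^ 2 / 2, by positivity, fun x hx s hs => ?_⟩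
  obtain ⟨n, hnN, hsn, hnW⟩ := hN s hs
  have hφn : ∀ s ∈ D.sets n, φ s = 0 := fun s hs => hφW fun hsW => hnW hs (interior_subset hsW)
  have hφ : ∀ s, |φ s| ≤ 1 := fun s => (abs_of_nonneg (hφ01 s).1).trans_le (hφ01 s).2
  have hsup := half_pow_mul_sq_supOn_le_of_mem_ballSlice hx (hφt rfl) hφ hφn
  refine (le_supOn _ hsn).trans (le_of_sq_le_sq ?_ hρ.le)
  refine le_of_mul_le_mul_left ?_ (show (0 : ℝ) < (1 / 2) ^ (n + 1) by positivity)
  calc (1 / 2 : ℝ) ^ (n + 1) * supOn (D.sets n) (XSpace.equiv D x) ^ 2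
      ≤ (1 / 2) ^ (N + 1) * ρ ^ 2 := by linarith
    _ ≤ (1 / 2) ^ (n + 1) * ρ ^ 2 :=
        mul_le_mul_of_nonneg_right
          (pow_le_pow_of_le_one (by norm_num) (by norm_num) (by omega)) (sq_nonneg ρ)

end ThinSlices

section AlmostDisjoint

variable {κ : Type*} [Fintype κ] {ρ : ℝ}

theorem sq_sum_le_of_almost_disjoint {a : κ → ℝ} (hρ : 0 ≤ ρ)
    (ha : Pairwise fun j k => |a j| ≤ ρ ∨ |a k| ≤ ρ) :
    (∑ j, a j) ^ 2 ≤ 2 * ∑ j, a j ^ 2 + 2 * (Fintype.card κ * ρ) ^ 2 := by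
  classical
  have hsmall : ∀ F : Finset κ, (∀ k ∈ F, |a k| ≤ ρ) →
      (∑ k ∈ F, a k) ^ 2 ≤ (Fintype.card κ * ρ) ^ 2 := fun F hF => by
    refine sq_le_sq.2 (le_trans ?_ (le_abs_self _))
    calc |∑ k ∈ F, a k| ≤ ∑ k ∈ F, |a k| := Finset.abs_sum_le_sum_abs _ _
      _ ≤ F.card * ρ := by simpa only [nsmul_eq_mul] using Finset.sum_le_card_nsmul _ _ _ hF
      _ ≤ Fintype.card κ * ρ := by gcongr; exact Finset.card_le_univ F
  by_cases hlarge : ∃ j, ρ < |a j|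
  · obtain ⟨j, hj⟩ := hlarge
    have hrest := hsmall (Finset.univ.erase j) fun k hk =>
      (ha (Finset.ne_of_mem_erase hk)).resolve_right hj.not_ge
    have hterm : a j ^ 2 ≤ ∑ j, a j ^ 2 :=
      Finset.single_le_sum (f := fun j => a j ^ 2) (fun k _ => sq_nonneg _) (Finset.mem_univ j)
    rw [← Finset.add_sum_erase _ _ (Finset.mem_univ j)]
    linarith [add_sq_le (a := a j) (b := ∑ k ∈ Finset.univ.erase j, a k)]
  · push Not at hlarge
    have hnonneg : 0 ≤ ∑ j, a j ^ 2 := Finset.sum_nonneg fun _ _ => sq_nonneg _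
    linarith [hsmall Finset.univ fun k _ => hlarge k, sq_nonneg (Fintype.card κ * ρ)]

variable {x : κ → C(unitInterval, ℝ)}

theorem sq_supOn_sum_le_of_almost_disjoint (hρ : 0 ≤ ρ)
    (hx : Pairwise fun j k => ∀ s, |x j s| ≤ ρ ∨ |x k s| ≤ ρ) (A : Set unitInterval) :
    supOn A (∑ j, x j) ^ 2 ≤ 2 * ∑ j, supOn A (x j) ^ 2 + 2 * (Fintype.card κ * ρ) ^ 2 := by
  refine (Real.le_sqrt (supOn_nonneg _ _) (by positivity)).1 <|
    supOn_le (Real.sqrt_nonneg _) fun s hs => Real.abs_le_sqrt ?_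
  rw [ContinuousMap.sum_apply]
  refine (sq_sum_le_of_almost_disjoint hρ fun j k hjk => hx hjk s).trans ?_
  gcongr ?_ + _
  gcongr 2 * ∑ j, ?_ with j
  exact sq_le_sq.2 ((le_supOn (x j) hs).trans (le_abs_self _))

theorem sq_dNorm_sum_le_of_almost_disjoint (D : NbhdBase) (hρ : 0 ≤ ρ)
    (hx : Pairwise fun j k => ∀ s, |x j s| ≤ ρ ∨ |x k s| ≤ ρ) :
    dNorm D (∑ j, x j) ^ 2 ≤ 2 * ∑ j, dNorm D (x j) ^ 2 + 2 * (Fintype.card κ * ρ) ^ 2 := by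
  have hbound := ((hasSum_sum fun j (_ : j ∈ Finset.univ) => hasSum_sq_dNorm D (x j)).mul_left
    2).add (hasSum_half_pow_succ.mul_right (2 * (Fintype.card κ * ρ) ^ 2))
  rw [one_mul] at hbound
  refine hasSum_le (fun n => ?_) (hasSum_sq_dNorm D _) hbound
  have hterm := mul_le_mul_of_nonneg_left
    (sq_supOn_sum_le_of_almost_disjoint hρ hx (D.sets n)) (show (0 : ℝ) ≤ (1 / 2) ^ (n + 1) by
      positivity)
  rwa [mul_add, mul_left_comm, Finset.mul_sum] at hterm

end AlmostDisjoint

theorem XSpace.norm_sum_inv_smul_le_of_almost_disjoint {D : NbhdBase} {m : ℕ} (hm : 0 < m)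
    {x : Fin m → XSpace D} (hx : ∀ j, ‖x j‖ ≤ 1)
    (hdisj : Pairwise fun j k => ∀ s,
      |XSpace.equiv D (x j) s| ≤ (m : ℝ)⁻¹ ∨ |XSpace.equiv D (x k) s| ≤ (m : ℝ)⁻¹) :
    ‖∑ j, (m : ℝ)⁻¹ • x j‖ ≤ 2 / √m := by
  have hm0 : (0 : ℝ) < m := Nat.cast_pos.2 hm
  have hunit : ∑ j, dNorm D (XSpace.equiv D (x j)) ^ 2 ≤ m := by
    simpa [← XSpace.norm_eq_dNorm] using Finset.sum_le_card_nsmul Finset.univ _ 1 fun j _ =>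
      pow_le_one₀ (n := 2) (norm_nonneg (x j)) (hx j)
  have hsum : dNorm D (∑ j, XSpace.equiv D (x j)) ≤ 2 * √m := by
    refine le_of_sq_le_sq ?_ (by positivity)
    have h := sq_dNorm_sum_le_of_almost_disjoint D (inv_pos.2 hm0).le hdisj
    rw [Fintype.card_fin, mul_inv_cancel₀ hm0.ne'] at h
    rw [mul_pow, Real.sq_sqrt hm0.le]
    linarith [Nat.one_le_cast (α := ℝ).2 hm]
  rw [← Finset.smul_sum, norm_smul, norm_inv, Real.norm_natCast, XSpace.norm_eq_dNorm, map_sum,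
    inv_mul_le_iff₀ hm0]
  calc dNorm D (∑ j, XSpace.equiv D (x j)) ≤ 2 * √m := hsum
    _ = m * (2 / √m) := by rw [mul_div_left_comm, Real.div_sqrt]

theorem XSpace.exists_isConvexCombOfSlices_subset_closedBall (D : NbhdBase) {m : ℕ} (hm : 0 < m) :
    ∃ C : Set (XSpace D), IsConvexCombOfSlices C ∧ C ⊆ Metric.closedBall 0 (2 / √m) := by
  have hm0 : (0 : ℝ) < m := Nat.cast_pos.2 hm
  have : Infinite unitInterval := (Icc_infinite zero_lt_one).to_subtype
  obtain ⟨V, hVinf, hV, hVdisj⟩ := exists_seq_infinite_isOpen_pairwise_disjoint unitInterval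
  choose t ht using fun j => (hVinf j).nonempty
  choose η hη hsmall using fun j =>
    XSpace.exists_ballSlice_abs_le D (hV j) (ht j) (inv_pos.2 hm0)
  refine ⟨_, ⟨m, fun _ => (m : ℝ)⁻¹, fun j => XSpace.unitEval D (t j), fun j => η j,
    fun _ => (inv_pos.2 hm0).le, by simp [hm0.ne'], fun j => XSpace.norm_unitEval D _,
    fun j => hη j, rfl⟩, ?_⟩
  rintro _ ⟨x, hx, rfl⟩
  rw [mem_closedBall_zero_iff]
  refine XSpace.norm_sum_inv_smul_le_of_almost_disjoint hm
    (fun j => mem_closedBall_zero_iff.1 (hx j).1) fun j k hjk s => ?_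
  by_cases hs : s ∈ V j
  · exact .inr (hsmall k _ (hx k) s (disjoint_left.1 (hVdisj (Fin.val_injective.ne hjk)) hs))
  · exact .inl (hsmall j _ (hx j) s hs)

theorem XSpace.hasSmallSliceCombs (D : NbhdBase) : HasSmallSliceCombs (XSpace D) := by
  intro r hr
  have hlim : Tendsto (fun m : ℕ => 2 * (2 / √m)) atTop (𝓝 0) := by
    simpa only [mul_zero, Function.comp_def] using (tendsto_const_nhds.div_atTop
      (Real.tendsto_sqrt_atTop.comp tendsto_natCast_atTop_atTop)).const_mul (2 : ℝ)
  obtain ⟨m, hmr, hm⟩ := ((hlim.eventually_lt_const hr).and (eventually_gt_atTop 0)).exists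
  obtain ⟨C, hC, hCball⟩ := XSpace.exists_isConvexCombOfSlices_subset_closedBall D hm
  exact ⟨C, hC, (Metric.diam_le_of_subset_closedBall (by positivity) hCball).trans_lt hmr⟩

/-! ### `ℓ₂`-sums of the spaces `X_D` -/

instance XSpace.instNontrivial (D : NbhdBase) : Nontrivial (XSpace D) :=
  (XSpace.equiv D).toEquiv.nontrivial

instance nontrivial_lp_two {ι : Type*} [Nonempty ι] {E : ι → Type*}
    [∀ i, NormedAddCommGroup (E i)] [∀ i, Nontrivial (E i)] : Nontrivial (lp E 2) := by
  classical
  exact (lp.isometry_single (E := E) (p := 2) (Classical.arbitrary ι)).injective.nontrivial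

theorem mainTheorem2_general {ι : Type*} [Nonempty ι] (D : ι → NbhdBase) :
    IsMLUR (lp (fun i => XSpace (D i)) 2) ∧
    HasD2P (lp (fun i => XSpace (D i)) 2) ∧
    HasLD2PPlus (lp (fun i => XSpace (D i)) 2) ∧
    ∀ r : ℝ, 0 < r → ∃ C : Set (lp (fun i => XSpace (D i)) 2),
      IsConvexCombOfSlices C ∧ Metric.diam C < r :=
  have hDD2P : HasSeqDD2P (lp (fun i => XSpace (D i)) 2) :=
    .lp_two fun i => XSpace.hasSeqDD2P (D i)
  ⟨.lp_two fun i => XSpace.isMLUR (D i), hDD2P.hasD2P, hDD2P.hasLD2PPlus,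
    HasSmallSliceCombs.lp_two (XSpace.hasSmallSliceCombs (D (Classical.arbitrary ι)))⟩

theorem mainTheorem2 (ε : ℕ → ℝ) (hpos : ∀ n, 0 < ε n) (hanti : StrictAnti ε)
    (hlim : Tendsto ε atTop (𝓝 0)) :
    IsMLUR (L2SumXSpace ε hpos hlim) ∧
    HasD2P (L2SumXSpace ε hpos hlim) ∧
    HasLD2PPlus (L2SumXSpace ε hpos hlim) ∧
    ∀ r : ℝ, 0 < r → ∃ C : Set (L2SumXSpace ε hpos hlim),
      IsConvexCombOfSlices C ∧ Metric.diam C < r :=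
  mainTheorem2_general (dyadicBase ε hpos hlim)
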